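/- Let $\Sigma$ be a compact smooth Riemannian 2-manifold without boundary, let $q>0$, let $f:[0,\infty)\to\mathbb R$ be smooth and strictly increasing with $f'(t)>0$ for all $t>0$, and let $s\in\mathbb R$ satisfy $f(0)<s<\sup_{t>0}f(t)$. Then there is exactly one $t\ge 0$ with $f(t)=s$; it is positive and is denoted $f^{-1}(s)$. Consider the system without vortex points \[ -\Delta u=q\,\bigl(v-f(e^{u})\bigr),\qquad -\Delta v=q\left[f'(e^{u})\,e^{u}\,(s-v)-q\,\bigl(v-f(e^{u})\bigr)\right]\qquad\text{on }\Sigma, \] where $\Delta$ is the Laplace–Beltrami operator. A solution is a pair $(u,v)\in H^1(\Sigma)\times H^1(\Sigma)$ for which both right-hand sides are integrable and both equations hold in the sense of distributions, that is, $\int_\Sigma\langle\nabla u,\nabla\varphi\rangle=\int_\Sigma h\,\varphi$ for all $\varphi\in C^\infty(\Sigma)$, with $h$ the right-hand side of the first equation, and likewise for $v$ and the second equation. Then $(u,v)$ is a solution if and only if $(e^{u},v)=(f^{-1}(s),s)$ almost everywhere on $\Sigma$. So the system admits only this trivial solution. -/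

import Mathlib

open Set Filter Topology MeasureTheory Bundle Manifold
open scoped ContDiff

noncomputable section

/-- The coordinate plane on which surfaces are modelled. -/
abbrev Plane : Type := EuclideanSpace ℝ (Fin 2)

section Surface

variable {M : Type*} [TopologicalSpace M] [ChartedSpace Plane M] [IsManifold (𝓡 2) ∞ M]
  [RiemannianBundle (fun x : M => TangentSpace (𝓡 2) x)]

/-- The coordinate tangent vector `∂_i` of the chart at `c`, at the point with coordinates `z`. -/
def coordVector (c : M) (z : Plane) (i : Fin 2) :
    TangentSpace (𝓡 2) ((chartAt Plane c).symm z) :=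
  mfderiv (𝓡 2) (𝓡 2) (chartAt Plane c).symm z (EuclideanSpace.single i (1 : ℝ) : Plane)

/-- The matrix `g_ij = ⟨∂_i, ∂_j⟩` of the metric in the chart at `c`. -/
def metricMatrix (c : M) (z : Plane) : Matrix (Fin 2) (Fin 2) ℝ :=
  Matrix.of fun i j => inner ℝ (coordVector c z i) (coordVector c z j)

/-- The measure `√(det g) dz` in the domain of the chart at `c`, extended by `0` to `M`. -/
def chartVolume [MeasurableSpace M] (c : M) : Measure M :=
  Measure.map (chartAt Plane c).symm
    (((volume : Measure Plane).restrict (chartAt Plane c).target).withDensity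
      fun z => ENNReal.ofReal (Real.sqrt (metricMatrix c z).det))

variable (M) in
/-- The Riemannian volume. The measures `√(det g) dz` agree where charts overlap, and their
supremum in the complete lattice of measures is the measure on `M` that restricts to each of
them. -/
def riemannianVolume [MeasurableSpace M] : Measure M := ⨆ c : M, chartVolume c

instance (x : M) : FiniteDimensional ℝ (TangentSpace (𝓡 2) x) :=
  inferInstanceAs (FiniteDimensional ℝ Plane)

instance (x : M) : CompleteSpace (TangentSpace (𝓡 2) x) :=
  FiniteDimensional.complete ℝ (TangentSpace (𝓡 2) x)

/-- The Riemannian gradient: the tangent vector at `x` with `⟨grad φ x, X⟩ = dφ_x(X)` for all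
tangent vectors `X` at `x`. -/
def riemannianGrad (φ : M → ℝ) (x : M) : TangentSpace (𝓡 2) x :=
  (InnerProductSpace.toDual ℝ (TangentSpace (𝓡 2) x)).symm (mfderiv (𝓡 2) 𝓘(ℝ, ℝ) φ x)

/-- The functions `w k` are smooth, converge to `u` in `L²` and form a Cauchy sequence for the
`H¹` norm. So `u` lies in `H¹` (the completion of the smooth functions in the `H¹` norm), and
`w k → u` in `H¹`. -/
structure IsH1Approx [MeasurableSpace M] (u : M → ℝ) (w : ℕ → M → ℝ) : Prop where
  memLp : MemLp u 2 (riemannianVolume M)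
  smooth : ∀ k, ContMDiff (𝓡 2) 𝓘(ℝ, ℝ) ∞ (w k)
  tendsto : Tendsto (fun k => eLpNorm (w k - u) 2 (riemannianVolume M)) atTop (𝓝 0)
  cauchy : ∀ ε : ℝ, 0 < ε → ∃ N : ℕ, ∀ k ≥ N, ∀ l ≥ N,
    ∫ x, ‖riemannianGrad (w k) x - riemannianGrad (w l) x‖ ^ 2 ∂(riemannianVolume M) < ε

/-- `u ∈ H¹` solves `-Δu = h` in the sense of distributions, where `h ∈ L¹`:
`∫ ⟨∇u, ∇φ⟩ = ∫ h φ` for all smooth `φ`. The left side is the limit of `∫ ⟨∇(w k), ∇φ⟩` for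
smooth `w k → u` in `H¹`. -/
def IsWeakPoissonSolution [MeasurableSpace M] (u h : M → ℝ) : Prop :=
  Integrable h (riemannianVolume M) ∧
  ∃ w : ℕ → M → ℝ, IsH1Approx u w ∧
    ∀ φ : M → ℝ, ContMDiff (𝓡 2) 𝓘(ℝ, ℝ) ∞ φ →
      Tendsto
        (fun k => ∫ x, inner ℝ (riemannianGrad (w k) x) (riemannianGrad φ x)
          ∂(riemannianVolume M))
        atTop (𝓝 (∫ x, h x * φ x ∂(riemannianVolume M)))

/-- `(u, v) ∈ H¹ × H¹` is a weak solution of the system without vortex points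
`-Δu = q (v - f(e^u))`, `-Δv = q [f'(e^u) e^u (s - v) - q (v - f(e^u))]`.
Here `f` is a function on `[0, ∞)`, and `f'` its derivative there. -/
structure IsVortexFreeSolution [MeasurableSpace M] (f : ℝ → ℝ) (s q : ℝ) (u v : M → ℝ) :
    Prop where
  eq_u : IsWeakPoissonSolution u fun x => q * (v x - f (Real.exp (u x)))
  eq_v : IsWeakPoissonSolution v fun x =>
    q * (derivWithin f (Ici 0) (Real.exp (u x)) * Real.exp (u x) * (s - v x)
      - q * (v x - f (Real.exp (u x))))

end Surface

end

/-!
The uniqueness is a maximum principle in integral form. Write `F = f(e^u)`, `c = f'(e^u) e^u > 0` and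
`f(t) = s`. If `-Δu = h` weakly with `u ∈ H¹` and `h ∈ L¹`, then Kato's inequality
`∫ h sign(u - k) ≥ 0` holds (`IsWeakPoissonSolution.integral_mul_sign_nonneg`). For the first
equation with `k = log t` the sign is that of `F - s`; for the second equation take the level `s`.
Adding `q` times the first inequality to the second gives
`∫ (-q c |v - s| - q² (v - F) (sign(v - s) - sign(F - s))) ≥ 0`. Both terms of the integrand are
nonpositive, the second because the sign function is monotone. So they vanish, which gives `v = s`
and then `F = s` almost everywhere. No growth condition on `f` is needed, since the test functions
are bounded.

Kato's inequality is obtained by testing with `Φ ∘ w j`, for `Φ` a smooth bounded increasing function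
and `w j → u` the smooth approximations in `H¹`. Polarization gives
`⟨∇w k, ∇(Φ ∘ w j)⟩ ≥ -Φ'(w j) ‖∇w k - ∇w j‖² / 4`, whose integral is small by the Cauchy property.

These integrals are meaningful because inner products of gradients of smooth functions are
continuous (`continuous_inner_riemannianGrad`) and the Riemannian volume of a compact surface is
finite. The latter rests on the change of variables formula: the area elements of any two charts
agree on the overlap (`chartVolume_eq_of_subset_overlap`), so finitely many compact pieces of charts
bound the supremum over all charts. Finiteness also puts the constants in `L²`, which is needed for
the trivial solution to be one.
-/

open Set Filter Topology MeasureTheory Bundle Manifold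
open scoped ContDiff

/-! ### Gram matrices in an inner product space -/

section LinearAlgebra

open scoped Matrix

theorem continuousLinearMap_eq_sum_single (L : Plane →L[ℝ] Plane) (p : Plane) :
    L p = ∑ k, p k • L (EuclideanSpace.single k 1) := by
  have hp : p = ∑ k, p k • (EuclideanSpace.single k 1 : Plane) := by
    ext k
    fin_cases k <;> simp [Fin.sum_univ_two]
  conv_lhs => rw [hp]
  simp only [map_sum, map_smul]

/-- A change of frame with matrix `A` multiplies the Gram determinant by `(det A)²`. -/
theorem det_gram_of_eq_sum {ι V : Type*} [Fintype ι] [DecidableEq ι] [NormedAddCommGroup V]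
    [InnerProductSpace ℝ V] {v w : ι → V} (A : Matrix ι ι ℝ) (h : ∀ i, v i = ∑ k, A k i • w k) :
    (Matrix.gram ℝ v).det = A.det ^ 2 * (Matrix.gram ℝ w).det := by
  have hM : Matrix.gram ℝ v = A.transpose * Matrix.gram ℝ w * A := by
    ext i j
    simp only [Matrix.gram_apply, Matrix.mul_apply, Matrix.transpose_apply, h, sum_inner,
      inner_sum, inner_smul_left, inner_smul_right, Finset.sum_mul,
      Finset.mul_sum, conj_trivial]
    exact Finset.sum_congr rfl fun k _ => Finset.sum_congr rfl fun l _ => by ring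
  rw [hM, Matrix.det_mul, Matrix.det_mul, Matrix.det_transpose]
  ring

/-- The inner product in terms of the covariant coordinates `⟨w i, a⟩`: it is given by the inverse
of the Gram matrix of the basis `w`. -/
theorem inner_eq_dotProduct_gram_inv {ι V : Type*} [Fintype ι] [DecidableEq ι]
    [NormedAddCommGroup V] [InnerProductSpace ℝ V] {w : ι → V} (hw : LinearIndependent ℝ w)
    (hspan : ⊤ ≤ Submodule.span ℝ (Set.range w)) (a b : V) :
    inner ℝ a b = (fun i => inner ℝ (w i) a) ⬝ᵥ
      ((Matrix.gram ℝ w)⁻¹ *ᵥ fun i => inner ℝ (w i) b) := by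
  let B := Module.Basis.mk hw hspan
  have hb : b = ∑ i, B.repr b i • w i := by
    conv_lhs => rw [← B.sum_repr b]
    simp [B]
  have hG : (fun i => inner ℝ (w i) b) = Matrix.gram ℝ w *ᵥ (B.repr b) := by
    ext i
    conv_lhs => rw [hb]
    simp [inner_sum, inner_smul_right, Matrix.mulVec, dotProduct, mul_comm]
  have hdet : IsUnit (Matrix.gram ℝ w).det :=
    isUnit_iff_ne_zero.2 (Matrix.det_gram_ne_zero_iff_linearIndependent.2 hw)
  rw [hG, Matrix.mulVec_mulVec, Matrix.nonsing_inv_mul _ hdet, Matrix.one_mulVec]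
  conv_lhs => rw [hb]
  simp [inner_sum, inner_smul_right, dotProduct, mul_comm, real_inner_comm]

/-- By polarization: `4 ⟨a, b⟩ = ‖a + b‖² - ‖a - b‖²`. -/
theorem neg_norm_sq_sub_div_four_le_inner {V : Type*} [NormedAddCommGroup V]
    [InnerProductSpace ℝ V] (a b : V) : -(‖a - b‖ ^ 2 / 4) ≤ inner ℝ a b := by
  have h1 := norm_add_sq_real a b
  have h2 := norm_sub_sq_real a b
  nlinarith [sq_nonneg ‖a + b‖]

end LinearAlgebra

/-! ### The metric in a chart -/

section MetricMatrix

variable {M : Type*} [TopologicalSpace M] [ChartedSpace Plane M] [IsManifold (𝓡 2) ∞ M]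

/-- The coordinate field `∂_i` of a chart, as a map to the tangent bundle, is continuous. -/
theorem continuousOn_coordVector (c : M) (i : Fin 2) :
    ContinuousOn (fun z : Plane =>
      (⟨(chartAt Plane c).symm z, coordVector c z i⟩ : TangentBundle (𝓡 2) M))
      (chartAt Plane c).target := by
  have hopen := (chartAt Plane c).open_target
  have h1 := (contMDiffOn_chart_symm (I := 𝓡 2) (n := ∞) (x := c)).continuousOn_tangentMapWithin
    (by simp) hopen.uniqueMDiffOn
  have h2 : Continuous fun z : Plane =>
      (⟨z, (EuclideanSpace.single i (1 : ℝ) : Plane)⟩ : TangentBundle (𝓡 2) Plane) :=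
    (tangentBundleModelSpaceHomeomorph (𝓡 2)).symm.continuous.comp
      (continuous_id.prodMk continuous_const)
  refine (h1.comp h2.continuousOn (fun z hz => hz)).congr fun z hz => ?_
  simp only [Function.comp, tangentMapWithin]
  rw [mfderivWithin_of_isOpen hopen hz]
  rfl

theorem linearIndependent_coordVector (c : M) {z : Plane} (hz : z ∈ (chartAt Plane c).target) :
    LinearIndependent ℝ (coordVector c z) := by
  let L : Plane →L[ℝ] Plane := mfderiv (𝓡 2) (𝓡 2) (chartAt Plane c).symm z
  have hinj : Function.Injective L :=
    (mdifferentiable_chart (I := 𝓡 2) c).symm.mfderiv_injective hz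
  have hL := (EuclideanSpace.basisFun (Fin 2) ℝ).toBasis.linearIndependent.map'
    L.toLinearMap (LinearMap.ker_eq_bot.2 hinj)
  have heq : L.toLinearMap ∘ (EuclideanSpace.basisFun (Fin 2) ℝ).toBasis =
      fun i => L (EuclideanSpace.single i 1) := by
    ext1 i
    simp
  rw [heq] at hL
  exact hL

variable [RiemannianBundle (fun x : M => TangentSpace (𝓡 2) x)]

theorem det_metricMatrix_ne_zero (c : M) {z : Plane} (hz : z ∈ (chartAt Plane c).target) :
    (metricMatrix c z).det ≠ 0 := by
  change (Matrix.gram ℝ (coordVector c z)).det ≠ 0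
  rw [Matrix.det_gram_ne_zero_iff_linearIndependent]
  exact linearIndependent_coordVector c hz

variable [IsContMDiffRiemannianBundle (𝓡 2) ∞ Plane (fun x : M => TangentSpace (𝓡 2) x)]

instance : IsContinuousRiemannianBundle Plane (fun x : M => TangentSpace (𝓡 2) x) := by
  obtain ⟨g, hg, h⟩ := IsContMDiffRiemannianBundle.exists_contMDiff (IB := 𝓡 2) (n := ∞)
    (F := Plane) (E := fun x : M => TangentSpace (𝓡 2) x)
  exact ⟨g, hg.continuous, h⟩

theorem continuousOn_metricMatrix (c : M) :
    ContinuousOn (metricMatrix c) (chartAt Plane c).target := by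
  refine continuousOn_pi.2 fun i => continuousOn_pi.2 fun j => ?_
  exact (continuousOn_coordVector c i).inner_bundle (continuousOn_coordVector c j)

end MetricMatrix

/-! ### Change of chart -/

section Volume

variable {M : Type*} [TopologicalSpace M] [ChartedSpace Plane M] [IsManifold (𝓡 2) ∞ M]

theorem differentiableAt_chart_transition (c c' : M) {z : Plane}
    (hz : z ∈ (chartAt Plane c).target) (hz' : (chartAt Plane c).symm z ∈ (chartAt Plane c').source) :
    DifferentiableAt ℝ (chartAt Plane c' ∘ (chartAt Plane c).symm) z := by
  have h1 := (mdifferentiable_chart (I := 𝓡 2) c).mdifferentiableAt_symm hz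
  have h2 := (mdifferentiable_chart (I := 𝓡 2) c').mdifferentiableAt hz'
  exact mdifferentiableAt_iff_differentiableAt.1 (h2.comp z h1)

/-- The chain rule `∂_i = Σ_k (∂_i ψ^k) ∂'_k` for the transition map `ψ`. The two sides lie in
tangent spaces at points that are equal only propositionally, so the identity is stated in the
model space `Plane`. -/
theorem coordVector_transition (c c' : M) {z : Plane}
    (hz : z ∈ (chartAt Plane c).target) (hz' : (chartAt Plane c).symm z ∈ (chartAt Plane c').source)
    (i : Fin 2) :
    (coordVector c z i : Plane) =
      ∑ k, (fderiv ℝ (chartAt Plane c' ∘ (chartAt Plane c).symm) z (EuclideanSpace.single i 1)) k •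
        (coordVector c' (chartAt Plane c' ((chartAt Plane c).symm z)) k : Plane) := by
  set e := chartAt Plane c
  set e' := chartAt Plane c'
  set ψ := e' ∘ e.symm
  have hψ := differentiableAt_chart_transition c c' hz hz'
  have h3 : MDifferentiableAt (𝓡 2) (𝓡 2) e'.symm (ψ z) :=
    (mdifferentiable_chart (I := 𝓡 2) c').mdifferentiableAt_symm (e'.map_source hz')
  have h4 : mfderiv (𝓡 2) (𝓡 2) (e'.symm ∘ ψ) z = mfderiv (𝓡 2) (𝓡 2) e.symm z := by
    apply Filter.EventuallyEq.mfderiv_eq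
    filter_upwards [e.symm.continuousAt hz |>.preimage_mem_nhds
      (e'.open_source.mem_nhds hz')] with y hy
    exact e'.left_inv hy
  have h5 := mfderiv_comp z h3 hψ.mdifferentiableAt
  rw [mfderiv_eq_fderiv] at h5
  have h6 : (mfderiv (𝓡 2) (𝓡 2) e.symm z : Plane →L[ℝ] Plane) =
      (mfderiv (𝓡 2) (𝓡 2) e'.symm (ψ z) : Plane →L[ℝ] Plane).comp (fderiv ℝ ψ z) :=
    h4.symm.trans h5
  have h7 := DFunLike.congr_fun h6 (EuclideanSpace.single i 1)
  exact h7.trans (continuousLinearMap_eq_sum_single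
    (mfderiv (𝓡 2) (𝓡 2) e'.symm (ψ z) : Plane →L[ℝ] Plane)
    (fderiv ℝ ψ z (EuclideanSpace.single i 1)))

variable [RiemannianBundle (fun x : M => TangentSpace (𝓡 2) x)]

/-- The transformation rule of `det g` under a change of chart. -/
theorem det_metricMatrix_transition (c c' : M) {z : Plane}
    (hz : z ∈ (chartAt Plane c).target)
    (hz' : (chartAt Plane c).symm z ∈ (chartAt Plane c').source) :
    (metricMatrix c z).det =
      (fderiv ℝ (chartAt Plane c' ∘ (chartAt Plane c).symm) z).det ^ 2 *
        (metricMatrix c' (chartAt Plane c' ((chartAt Plane c).symm z))).det := by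
  have key := coordVector_transition c c' hz hz'
  set D := fderiv ℝ (chartAt Plane c' ∘ (chartAt Plane c).symm) z with hD
  set z' := chartAt Plane c' ((chartAt Plane c).symm z)
  have hx : (chartAt Plane c').symm z' = (chartAt Plane c).symm z :=
    (chartAt Plane c').left_inv hz'
  let A : Matrix (Fin 2) (Fin 2) ℝ := Matrix.of fun k i => (D (EuclideanSpace.single i 1)) k
  have hA : D.det = A.det := by
    rw [ContinuousLinearMap.det,
      ← LinearMap.det_toMatrix (EuclideanSpace.basisFun (Fin 2) ℝ).toBasis]
    congr 1
  -- Transports the vectors `∂'_k` to the tangent space at `e.symm z`, where `∂_i` lives.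
  have hG : ∀ (x : M), (chartAt Plane c').symm z' = x → metricMatrix c' z' =
      Matrix.gram ℝ fun i => (show TangentSpace (𝓡 2) x from (coordVector c' z' i : Plane)) := by
    rintro _ rfl
    rfl
  rw [hG _ hx, hA]
  exact det_gram_of_eq_sum (v := coordVector c z) A key

end Volume

/-! ### The Riemannian volume is finite -/

section Measure

variable {M : Type*} [TopologicalSpace M] [ChartedSpace Plane M] [MeasurableSpace M] [BorelSpace M]

theorem measurableSet_target_inter_preimage_chart_symm (c : M) {A : Set M}
    (hA : MeasurableSet A) :
    MeasurableSet ((chartAt Plane c).target ∩ (chartAt Plane c).symm ⁻¹' A) := by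
  set e := chartAt Plane c
  have h : Measurable (e.target.domRestrict e.symm) :=
    (continuousOn_iff_continuous_domRestrict.1 e.continuousOn_symm).measurable
  convert e.open_target.measurableSet.subtype_image (h hA) using 1
  ext z
  simp [Set.domRestrict_apply, and_comm]

variable [RiemannianBundle (fun x : M => TangentSpace (𝓡 2) x)]

theorem chartVolume_apply (c : M) {A : Set M} (hA : MeasurableSet A) :
    chartVolume c A =
      ∫⁻ z in (chartAt Plane c).target ∩ (chartAt Plane c).symm ⁻¹' A,
        ENNReal.ofReal (Real.sqrt (metricMatrix c z).det) := by
  set e := chartAt Plane c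
  -- `Measure.map` has the junk value `0` without this measurability.
  have hm : AEMeasurable e.symm (((volume : Measure Plane).restrict e.target).withDensity
      fun z => ENNReal.ofReal (Real.sqrt (metricMatrix c z).det)) :=
    (e.continuousOn_symm.aemeasurable e.open_target.measurableSet).mono_ac
      (withDensity_absolutelyContinuous _ _)
  rw [chartVolume, Measure.map_apply_of_aemeasurable hm hA, withDensity_apply',
    Measure.restrict_restrict' e.open_target.measurableSet, inter_comm]

/-- A chart volume is carried by the domain of its chart. -/
theorem chartVolume_inter_source (c : M) {A : Set M} (hA : MeasurableSet A) :
    chartVolume c A = chartVolume c (A ∩ (chartAt Plane c).source) := by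
  rw [chartVolume_apply c hA,
    chartVolume_apply c (hA.inter (chartAt Plane c).open_source.measurableSet)]
  congr 2
  ext z
  constructor
  · exact fun h => ⟨h.1, h.2, (chartAt Plane c).map_target h.1⟩
  · exact fun h => ⟨h.1, h.2.1⟩

variable [IsManifold (𝓡 2) ∞ M]

/-- The Riemannian area elements of two charts agree on the overlap, by the change of variables
formula. -/
theorem chartVolume_eq_of_subset_overlap (c c' : M) {A : Set M} (hA : MeasurableSet A)
    (hc : A ⊆ (chartAt Plane c).source) (hc' : A ⊆ (chartAt Plane c').source) :
    chartVolume c A = chartVolume c' A := by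
  have hS := measurableSet_target_inter_preimage_chart_symm c hA
  rw [chartVolume_apply c hA, chartVolume_apply c' hA]
  set e := chartAt Plane c with he
  set e' := chartAt Plane c' with he'
  have himage : e'.target ∩ e'.symm ⁻¹' A = (e' ∘ e.symm) '' (e.target ∩ e.symm ⁻¹' A) := by
    ext y
    constructor
    · rintro ⟨hy, hyA⟩
      refine ⟨e (e'.symm y), ⟨e.map_source (hc hyA), ?_⟩, ?_⟩
      · simpa [e.left_inv (hc hyA)] using hyA
      · simp [e.left_inv (hc hyA), e'.right_inv hy]
    · rintro ⟨z, ⟨hz, hzA⟩, rfl⟩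
      refine ⟨e'.map_source (hc' hzA), ?_⟩
      simpa [e'.left_inv (hc' hzA)] using hzA
  rw [himage, lintegral_image_eq_lintegral_abs_det_fderiv_mul volume hS
    (f' := fun z => fderiv ℝ (e' ∘ e.symm) z)]
  · refine setLIntegral_congr_fun hS fun z hz => ?_
    rw [det_metricMatrix_transition c c' hz.1 (hc' hz.2), Real.sqrt_mul (sq_nonneg _),
      Real.sqrt_sq_eq_abs, ENNReal.ofReal_mul (abs_nonneg _)]
    rfl
  · exact fun z hz => (differentiableAt_chart_transition c c' hz.1
      (hc' hz.2)).hasFDerivAt.hasFDerivWithinAt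
  · intro z hz y hy h
    exact e.symm.injOn hz.1 hy.1 (e'.injOn (hc' hz.2) (hc' hy.2) h)

variable [IsContMDiffRiemannianBundle (𝓡 2) ∞ Plane (fun x : M => TangentSpace (𝓡 2) x)]

theorem chartVolume_lt_top_of_isCompact [T2Space M] (c : M) {K : Set M} (hK : IsCompact K)
    (hKc : K ⊆ (chartAt Plane c).source) : chartVolume c K < ⊤ := by
  rw [chartVolume_apply c hK.measurableSet]
  set e := chartAt Plane c
  have himage : e.target ∩ e.symm ⁻¹' K = e '' K := by
    rw [e.image_eq_target_inter_inv_preimage hKc]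
  have hcpt : IsCompact (e '' K) := hK.image_of_continuousOn (e.continuousOn.mono hKc)
  have hcont : ContinuousOn (fun z => Real.sqrt (metricMatrix c z).det) (e '' K) := by
    have hsub : e '' K ⊆ e.target := by
      rintro _ ⟨x, hx, rfl⟩
      exact e.map_source (hKc hx)
    have h := (continuousOn_metricMatrix c).mono hsub
    exact (Continuous.matrix_det continuous_id).comp_continuousOn h |>.sqrt
  rw [himage]
  exact (hcont.integrableOn_compact hcpt).lintegral_lt_top

/-- Finitely many compact pieces of charts cover a compact surface, and by consistency of the area
elements they bound every chart volume at once. -/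
instance [T2Space M] [CompactSpace M] : IsFiniteMeasure (riemannianVolume M) := by
  have : LocallyCompactSpace M := ChartedSpace.locallyCompactSpace Plane M
  have hK : ∀ x : M, ∃ K : Set M, K ∈ 𝓝 x ∧ K ⊆ (chartAt Plane x).source ∧ IsCompact K :=
    fun x => local_compact_nhds ((chartAt Plane x).open_source.mem_nhds (mem_chart_source Plane x))
  choose K hKx hKs hKc using hK
  obtain ⟨t, ht⟩ := isCompact_univ.elim_nhds_subcover K fun x _ => hKx x
  let μ : Measure M := ∑ x ∈ t, (chartVolume x).restrict (K x)
  have hle : riemannianVolume M ≤ μ := by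
    refine iSup_le fun c => Measure.le_iff.2 fun B hB => ?_
    have hBK : ∀ x : M, MeasurableSet (B ∩ K x) := fun x => hB.inter (hKc x).measurableSet
    have hsrc : ∀ x : M, MeasurableSet (chartAt Plane x).source :=
      fun x => (chartAt Plane x).open_source.measurableSet
    calc chartVolume c B ≤ chartVolume c (⋃ x ∈ t, B ∩ K x) := by
          refine measure_mono fun y hy => ?_
          obtain ⟨x, hx, hyx⟩ := mem_iUnion₂.1 (ht.2 (mem_univ y))
          exact mem_iUnion₂.2 ⟨x, hx, hy, hyx⟩
      _ ≤ ∑ x ∈ t, chartVolume c (B ∩ K x) := measure_biUnion_finset_le _ _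
      _ ≤ ∑ x ∈ t, chartVolume x (B ∩ K x) := Finset.sum_le_sum fun x _ => by
          rw [chartVolume_inter_source c (hBK x), chartVolume_eq_of_subset_overlap c x
            ((hBK x).inter (hsrc c)) inter_subset_right
            (inter_subset_left.trans (inter_subset_right.trans (hKs x)))]
          exact measure_mono inter_subset_left
      _ = μ B := by
          simp only [μ, Measure.coe_finsetSum, Finset.sum_apply]
          exact Finset.sum_congr rfl fun x _ => (Measure.restrict_apply hB).symm
  refine ⟨(Measure.le_iff'.1 hle univ).trans_lt ?_⟩
  simp only [μ, Measure.coe_finsetSum, Finset.sum_apply, Measure.restrict_apply_univ]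
  exact ENNReal.sum_lt_top.2 fun x _ => chartVolume_lt_top_of_isCompact x (hKc x) (hKs x)

end Measure

/-! ### Gradients of smooth functions -/

section Gradient

open scoped Matrix

variable {M : Type*} [TopologicalSpace M] [ChartedSpace Plane M]
  [RiemannianBundle (fun x : M => TangentSpace (𝓡 2) x)]

theorem inner_riemannianGrad (φ : M → ℝ) (x : M) (X : TangentSpace (𝓡 2) x) :
    inner ℝ (riemannianGrad φ x) X = mfderiv (𝓡 2) 𝓘(ℝ, ℝ) φ x X :=
  InnerProductSpace.toDual_symm_apply

theorem riemannianGrad_const (r : ℝ) (x : M) : riemannianGrad (fun _ : M => r) x = 0 := by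
  rw [riemannianGrad, mfderiv_const]
  exact map_zero _

theorem riemannianGrad_comp {Φ : ℝ → ℝ} (hΦ : Differentiable ℝ Φ) {φ : M → ℝ}
    {x : M} (hφ : MDifferentiableAt (𝓡 2) 𝓘(ℝ, ℝ) φ x) :
    riemannianGrad (Φ ∘ φ) x = deriv Φ (φ x) • riemannianGrad φ x := by
  refine ext_inner_right ℝ fun X => ?_
  rw [inner_smul_left, inner_riemannianGrad, inner_riemannianGrad,
    mfderiv_comp x (hΦ (φ x)).mdifferentiableAt hφ, mfderiv_eq_fderiv]
  change fderiv ℝ Φ (φ x) (mfderiv (𝓡 2) 𝓘(ℝ, ℝ) φ x X) = _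
  exact (fderiv_eq_smul_deriv _).trans (mul_comm _ _)

variable [IsManifold (𝓡 2) ∞ M]

theorem inner_coordVector_riemannianGrad {a : M → ℝ} (ha : ContMDiff (𝓡 2) 𝓘(ℝ, ℝ) ∞ a) (c : M)
    {z : Plane}
    (hz : z ∈ (chartAt Plane c).target) (i : Fin 2) :
    inner ℝ (coordVector c z i) (riemannianGrad a ((chartAt Plane c).symm z)) =
      fderiv ℝ (a ∘ (chartAt Plane c).symm) z (EuclideanSpace.single i 1) := by
  rw [real_inner_comm, inner_riemannianGrad, ← mfderiv_eq_fderiv]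
  rw [mfderiv_comp z (ha.mdifferentiableAt (by simp))
    ((mdifferentiable_chart (I := 𝓡 2) c).mdifferentiableAt_symm hz)]
  rfl

variable [IsContMDiffRiemannianBundle (𝓡 2) ∞ Plane (fun x : M => TangentSpace (𝓡 2) x)]

/-- In coordinates `⟨∇a, ∇b⟩ = g^{ij} ∂_i a ∂_j b`, and the inverse metric is continuous. -/
theorem continuous_inner_riemannianGrad {a b : M → ℝ} (ha : ContMDiff (𝓡 2) 𝓘(ℝ, ℝ) ∞ a)
    (hb : ContMDiff (𝓡 2) 𝓘(ℝ, ℝ) ∞ b) :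
    Continuous fun x => inner ℝ (riemannianGrad a x) (riemannianGrad b x) := by
  refine continuous_iff_continuousAt.2 fun c => ?_
  set e := chartAt Plane c
  have hd : ∀ a : M → ℝ, ContMDiff (𝓡 2) 𝓘(ℝ, ℝ) ∞ a →
      ContinuousOn (fun z i => fderiv ℝ (a ∘ e.symm) z (EuclideanSpace.single i 1)) e.target := by
    intro a ha
    have h : ContDiffOn ℝ ∞ (a ∘ e.symm) e.target :=
      (ha.comp_contMDiffOn (contMDiffOn_chart_symm (I := 𝓡 2) (n := ∞))).contDiffOn
    have h' := h.continuousOn_fderiv_of_isOpen e.open_target (by simp)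
    exact continuousOn_pi.2 fun i => h'.clm_apply continuousOn_const
  have hG : ContinuousOn (fun z => (metricMatrix c z)⁻¹) e.target := by
    simp only [Matrix.inv_def, Ring.inverse_eq_inv']
    have h := continuousOn_metricMatrix c
    exact (((Continuous.matrix_det continuous_id).comp_continuousOn h).inv₀
      fun z hz => det_metricMatrix_ne_zero c hz).smul
      ((Continuous.matrix_adjugate continuous_id).comp_continuousOn h)
  have hH : ContinuousOn (fun z => inner ℝ (riemannianGrad a (e.symm z))
      (riemannianGrad b (e.symm z))) e.target := by
    have h1 : ContinuousOn (fun z =>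
      (fun i => fderiv ℝ (a ∘ e.symm) z (EuclideanSpace.single i 1)) ⬝ᵥ ((metricMatrix c z)⁻¹ *ᵥ
        fun i => fderiv ℝ (b ∘ e.symm) z (EuclideanSpace.single i 1))) e.target := by
      have h2 : Continuous fun p : (Fin 2 → ℝ) × Matrix (Fin 2) (Fin 2) ℝ × (Fin 2 → ℝ) =>
          p.1 ⬝ᵥ (p.2.1 *ᵥ p.2.2) :=
        continuous_fst.dotProduct (continuous_snd.fst.matrix_mulVec continuous_snd.snd)
      exact h2.comp_continuousOn ((hd a ha).prodMk (hG.prodMk (hd b hb)))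
    refine h1.congr fun z hz => ?_
    have hli := linearIndependent_coordVector c hz
    have hspan : ⊤ ≤ Submodule.span ℝ (Set.range (coordVector c z)) :=
      (hli.span_eq_top_of_card_eq_finrank (by
        change Fintype.card (Fin 2) = Module.finrank ℝ Plane
        simp)).ge
    rw [inner_eq_dotProduct_gram_inv hli hspan]
    simp only [inner_coordVector_riemannianGrad ha c hz, inner_coordVector_riemannianGrad hb c hz, e]
    rfl
  have hsrc : e.source ∈ 𝓝 c := e.open_source.mem_nhds (mem_chart_source Plane c)
  have hcomp : ContinuousAt ((fun z => inner ℝ (riemannianGrad a (e.symm z))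
      (riemannianGrad b (e.symm z))) ∘ e) c :=
    ((hH.comp e.continuousOn fun x hx => e.map_source hx).continuousAt hsrc)
  refine hcomp.congr ?_
  filter_upwards [hsrc] with x hx
  simp only [Function.comp]
  rw [e.left_inv hx]

theorem continuous_norm_sq_sub_riemannianGrad {a b : M → ℝ} (ha : ContMDiff (𝓡 2) 𝓘(ℝ, ℝ) ∞ a)
    (hb : ContMDiff (𝓡 2) 𝓘(ℝ, ℝ) ∞ b) :
    Continuous fun x => ‖riemannianGrad a x - riemannianGrad b x‖ ^ 2 := by
  simp only [← real_inner_self_eq_norm_sq, inner_sub_left, inner_sub_right]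
  exact ((continuous_inner_riemannianGrad ha ha).sub (continuous_inner_riemannianGrad hb ha)).sub
    ((continuous_inner_riemannianGrad ha hb).sub (continuous_inner_riemannianGrad hb hb))

end Gradient

/-! ### Kato's inequality -/

theorem measurable_real_sign : Measurable Real.sign := by
  unfold Real.sign
  exact Measurable.ite measurableSet_Iio measurable_const
    (Measurable.ite measurableSet_Ioi measurable_const measurable_const)

theorem abs_real_sign_le_one (r : ℝ) : |Real.sign r| ≤ 1 := by
  rcases Real.sign_apply_eq r with h | h | h <;> simp [h]

theorem tendsto_arctan_nat_mul (r : ℝ) :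
    Tendsto (fun n : ℕ => Real.arctan (n * r)) atTop (𝓝 (Real.pi / 2 * Real.sign r)) := by
  rcases lt_trichotomy r 0 with hr | rfl | hr
  · have h := tendsto_nhds_of_tendsto_nhdsWithin Real.tendsto_arctan_atBot
    rw [Real.sign_of_neg hr, mul_neg_one]
    exact h.comp (tendsto_natCast_atTop_atTop.atTop_mul_const_of_neg hr)
  · simp
  · have h := tendsto_nhds_of_tendsto_nhdsWithin Real.tendsto_arctan_atTop
    rw [Real.sign_of_pos hr, mul_one]
    exact h.comp (tendsto_natCast_atTop_atTop.atTop_mul_const hr)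

theorem IsWeakPoissonSolution.integrable_mul_sign {M : Type*} [TopologicalSpace M]
    [ChartedSpace Plane M] [RiemannianBundle (fun x : M => TangentSpace (𝓡 2) x)]
    [MeasurableSpace M] {u h : M → ℝ} (hu : IsWeakPoissonSolution u h) (k : ℝ) :
    Integrable (fun x => h x * Real.sign (u x - k)) (riemannianVolume M) := by
  obtain ⟨hint, w, hw, -⟩ := hu
  exact hint.mul_bdd (c := 1) (measurable_real_sign.comp_aemeasurable
    (hw.memLp.aestronglyMeasurable.aemeasurable.sub_const k)).aestronglyMeasurable
    (ae_of_all _ fun _ => abs_real_sign_le_one _)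

section Kato

variable {M : Type*} [TopologicalSpace M] [T2Space M] [CompactSpace M]
  [ChartedSpace Plane M] [IsManifold (𝓡 2) ∞ M]
  [RiemannianBundle (fun x : M => TangentSpace (𝓡 2) x)]
  [IsContMDiffRiemannianBundle (𝓡 2) ∞ Plane (fun x : M => TangentSpace (𝓡 2) x)]
  [MeasurableSpace M] [BorelSpace M]

theorem integrable_of_continuous {F : M → ℝ} (hF : Continuous F) :
    Integrable F (riemannianVolume M) := by
  rw [← integrableOn_univ]
  exact hF.continuousOn.integrableOn_compact isCompact_univ

/-- Pointwise `⟨∇a, ∇Φ(b)⟩ = Φ'(b) ⟨∇a, ∇b⟩ ≥ -Φ'(b) ‖∇a - ∇b‖² / 4`: the pairing of two smooth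
functions that are close in `H¹` is almost nonnegative. -/
theorem integral_inner_riemannianGrad_comp_ge {a b : M → ℝ} (ha : ContMDiff (𝓡 2) 𝓘(ℝ, ℝ) ∞ a)
    (hb : ContMDiff (𝓡 2) 𝓘(ℝ, ℝ) ∞ b) {Φ : ℝ → ℝ} (hΦ : ContDiff ℝ ∞ Φ)
    (hΦ0 : ∀ r, 0 ≤ deriv Φ r) {C : ℝ} (hΦC : ∀ r, deriv Φ r ≤ C) :
    -(C / 4) * ∫ x, ‖riemannianGrad a x - riemannianGrad b x‖ ^ 2 ∂(riemannianVolume M) ≤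
      ∫ x, inner ℝ (riemannianGrad a x) (riemannianGrad (Φ ∘ b) x) ∂(riemannianVolume M) := by
  have hΦb : ContMDiff (𝓡 2) 𝓘(ℝ, ℝ) ∞ (Φ ∘ b) := hΦ.contMDiff.comp hb
  rw [← integral_const_mul]
  refine integral_mono
    ((integrable_of_continuous (continuous_norm_sq_sub_riemannianGrad ha hb)).const_mul _)
    (integrable_of_continuous (continuous_inner_riemannianGrad ha hΦb)) fun x => ?_
  simp only
  rw [riemannianGrad_comp (hΦ.differentiable (by simp)) (hb.mdifferentiableAt (by simp)),
    inner_smul_right]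
  have h1 := neg_norm_sq_sub_div_four_le_inner (riemannianGrad a x) (riemannianGrad b x)
  have h2 := hΦ0 (b x)
  have h3 := hΦC (b x)
  nlinarith [mul_nonneg (sub_nonneg.2 h3) (sq_nonneg ‖riemannianGrad a x - riemannianGrad b x‖),
    mul_le_mul_of_nonneg_left h1 h2]

/-- Testing `-Δu = h` with a bounded increasing function of `u`: formally
`∫ h Φ(u) = ∫ Φ'(u) |∇u|² ≥ 0`. The admissible test functions are the `Φ ∘ w j` for the smooth
approximations `w j` of `u`. -/
theorem IsWeakPoissonSolution.integral_mul_comp_nonneg {u h : M → ℝ}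
    (hu : IsWeakPoissonSolution u h) {Φ : ℝ → ℝ} (hΦ : ContDiff ℝ ∞ Φ)
    (hΦ0 : ∀ r, 0 ≤ deriv Φ r) {C : ℝ} (hΦC : ∀ r, deriv Φ r ≤ C)
    {B : ℝ} (hΦB : ∀ r, |Φ r| ≤ B) :
    0 ≤ ∫ x, h x * Φ (u x) ∂(riemannianVolume M) := by
  obtain ⟨hint, w, hw, hlim⟩ := hu
  have hC : 0 ≤ C := (hΦ0 0).trans (hΦC 0)
  have hcont : ∀ k, Continuous (w k) := fun k => (hw.smooth k).continuous
  have hcomp : ∀ j, ContMDiff (𝓡 2) 𝓘(ℝ, ℝ) ∞ (Φ ∘ w j) := fun j =>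
    hΦ.contMDiff.comp (hw.smooth j)
  have hlower : ∀ ε : ℝ, 0 < ε → ∃ N : ℕ, ∀ j ≥ N,
      -(C / 4) * ε ≤ ∫ x, h x * (Φ ∘ w j) x ∂(riemannianVolume M) := by
    intro ε hε
    obtain ⟨N, hN⟩ := hw.cauchy ε hε
    refine ⟨N, fun j hj => ge_of_tendsto (hlim _ (hcomp j)) ?_⟩
    filter_upwards [eventually_ge_atTop N] with k hk
    refine le_trans ?_
      (integral_inner_riemannianGrad_comp_ge (hw.smooth k) (hw.smooth j) hΦ hΦ0 hΦC)
    exact mul_le_mul_of_nonpos_left (hN k hk j hj).le (by linarith)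
  obtain ⟨ns, hns, hae⟩ := (tendstoInMeasure_of_tendsto_eLpNorm two_ne_zero
    (fun k => (hcont k).aestronglyMeasurable) hw.memLp.aestronglyMeasurable
    hw.tendsto).exists_seq_tendsto_ae
  -- Boundedness of `Φ` gives domination by a multiple of `|h|`, although `h` is only in `L¹`.
  have hdct : Tendsto (fun j => ∫ x, h x * (Φ ∘ w (ns j)) x ∂(riemannianVolume M)) atTop
      (𝓝 (∫ x, h x * Φ (u x) ∂(riemannianVolume M))) := by
    refine tendsto_integral_of_dominated_convergence (fun x => |h x| * B) (fun j => ?_)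
      (hint.abs.mul_const B) (fun j => ?_) ?_
    · exact hint.aestronglyMeasurable.mul (hcomp (ns j)).continuous.aestronglyMeasurable
    · refine ae_of_all _ fun x => ?_
      rw [Real.norm_eq_abs, abs_mul]
      exact mul_le_mul_of_nonneg_left (hΦB _) (abs_nonneg _)
    · filter_upwards [hae] with x hx
      exact ((hΦ.continuous.tendsto (u x)).comp hx).const_mul (h x)
  refine le_of_forall_pos_le_add fun δ hδ => ?_
  obtain ⟨N, hN⟩ := hlower (δ / (C / 4 + 1)) (by positivity)
  have hle := ge_of_tendsto hdct
    ((hns.tendsto_atTop.eventually_ge_atTop N).mono fun j hj => hN (ns j) hj)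
  have : C / 4 * (δ / (C / 4 + 1)) ≤ δ := by
    rw [mul_div_assoc', div_le_iff₀ (by positivity)]
    nlinarith
  linarith

/-- Kato's inequality `∫ h sign(u - k) ≥ 0` for `-Δu = h`, from the tests `arctan (n (u - k))` as
`n → ∞`. -/
theorem IsWeakPoissonSolution.integral_mul_sign_nonneg {u h : M → ℝ}
    (hu : IsWeakPoissonSolution u h) (k : ℝ) :
    0 ≤ ∫ x, h x * Real.sign (u x - k) ∂(riemannianVolume M) := by
  have hmeas : AEStronglyMeasurable u (riemannianVolume M) := by
    obtain ⟨-, w, hw, -⟩ := hu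
    exact hw.memLp.aestronglyMeasurable
  have hstep : ∀ n : ℕ,
      0 ≤ ∫ x, h x * Real.arctan (n * (u x - k)) ∂(riemannianVolume M) := by
    intro n
    have hderiv : ∀ r : ℝ, HasDerivAt (fun r : ℝ => Real.arctan (n * (r - k)))
        (1 / (1 + (n * (r - k)) ^ 2) * (n * 1)) r := fun r =>
      (((hasDerivAt_id r).sub_const k).const_mul (n : ℝ)).arctan
    refine hu.integral_mul_comp_nonneg (Φ := fun r => Real.arctan (n * (r - k))) (C := n)
      (B := Real.pi / 2) (Real.contDiff_arctan.comp (by fun_prop)) (fun r => ?_) (fun r => ?_)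
      fun r => ?_
    · rw [(hderiv r).deriv]
      positivity
    · rw [(hderiv r).deriv, mul_one]
      refine mul_le_of_le_one_left (Nat.cast_nonneg n) ?_
      exact div_le_one_of_le₀ (by nlinarith [sq_nonneg (n * (r - k))]) (by positivity)
    · exact abs_le.2 ⟨(Real.neg_pi_div_two_lt_arctan _).le, (Real.arctan_lt_pi_div_two _).le⟩
  have hdct : Tendsto (fun n : ℕ => ∫ x, h x * Real.arctan (n * (u x - k)) ∂(riemannianVolume M))
      atTop (𝓝 (∫ x, h x * (Real.pi / 2 * Real.sign (u x - k)) ∂(riemannianVolume M))) := by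
    refine tendsto_integral_of_dominated_convergence (fun x => |h x| * (Real.pi / 2)) (fun n => ?_)
      (hu.1.abs.mul_const _) (fun n => ?_) ?_
    · exact hu.1.aestronglyMeasurable.mul (Real.continuous_arctan.comp_aestronglyMeasurable
        ((hmeas.sub aestronglyMeasurable_const).const_mul (n : ℝ)))
    · refine ae_of_all _ fun x => ?_
      rw [Real.norm_eq_abs, abs_mul]
      exact mul_le_mul_of_nonneg_left (abs_le.2 ⟨(Real.neg_pi_div_two_lt_arctan _).le,
        (Real.arctan_lt_pi_div_two _).le⟩) (abs_nonneg _)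
    · exact ae_of_all _ fun x => (tendsto_arctan_nat_mul _).const_mul _
  have hle := ge_of_tendsto' hdct hstep
  have heq : (fun x => h x * (Real.pi / 2 * Real.sign (u x - k))) =
      fun x => Real.pi / 2 * (h x * Real.sign (u x - k)) := by
    ext x
    ring
  rw [heq, integral_const_mul] at hle
  exact nonneg_of_mul_nonneg_right hle (by positivity)

theorem isWeakPoissonSolution_of_ae_const {u h : M → ℝ} {r : ℝ}
    (hu : u =ᵐ[riemannianVolume M] fun _ => r) (hh : h =ᵐ[riemannianVolume M] 0) :
    IsWeakPoissonSolution u h := by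
  refine ⟨(integrable_zero _ _ _).congr hh.symm, fun _ _ => r,
    ⟨(memLp_const r).ae_eq hu.symm, fun _ => contMDiff_const, ?_, ?_⟩, fun φ _ => ?_⟩
  · have h0 : ((fun _ : M => r) - u) =ᵐ[riemannianVolume M] 0 := by
      filter_upwards [hu] with x hx
      simp [hx]
    simp only [eLpNorm_congr_ae h0, eLpNorm_zero]
    exact tendsto_const_nhds
  · intro ε hε
    exact ⟨0, fun k _ l _ => by simpa using hε⟩
  · have h0 : ∫ x, h x * φ x ∂(riemannianVolume M) = 0 := by
      refine integral_eq_zero_of_ae ?_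
      filter_upwards [hh] with x hx
      simp [hx]
    simp [h0, riemannianGrad_const]

end Kato

/-! ### Uniqueness for the system -/

section SignPairing

theorem sub_mul_sign_sub_sign_nonneg (v F s : ℝ) :
    0 ≤ (v - F) * (Real.sign (v - s) - Real.sign (F - s)) := by
  rcases lt_trichotomy v s with hv | hv | hv <;> rcases lt_trichotomy F s with hF | hF | hF <;>
    simp [hv, hF, Real.sign_of_neg, Real.sign_of_pos] <;> nlinarith

theorem eq_of_sub_mul_sign_eq_zero {F s : ℝ} (h : (F - s) * Real.sign (F - s) = 0) : F = s := by
  rcases mul_eq_zero.1 h with h | h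
  · exact sub_eq_zero.1 h
  · exact sub_eq_zero.1 (Real.sign_eq_zero_iff.1 h)

theorem mul_real_sign_nonneg (r : ℝ) : 0 ≤ r * Real.sign r := by
  rw [mul_comm]
  exact Real.sign_mul_nonneg r

/-- With `F = f(e^u)` and `c = f'(e^u) e^u`, the integrands of the two Kato inequalities add up, with
weight `q` on the first equation, to
`-q c |v - s| - q² (v - F) (sign(v - s) - sign(F - s))`. -/
theorem sign_pairing_nonpos {q c v F s : ℝ} (hq : 0 < q) (hc : 0 < c) :
    q * (c * (s - v) - q * (v - F)) * Real.sign (v - s) +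
      q * (q * (v - F) * Real.sign (F - s)) ≤ 0 := by
  have h1 := mul_nonneg (mul_pos hq hc).le (mul_real_sign_nonneg (v - s))
  have h2 := mul_nonneg (mul_pos hq hq).le (sub_mul_sign_sub_sign_nonneg v F s)
  linarith

theorem eq_of_sign_pairing_eq_zero {q c v F s : ℝ} (hq : 0 < q) (hc : 0 < c)
    (h : q * (c * (s - v) - q * (v - F)) * Real.sign (v - s) +
      q * (q * (v - F) * Real.sign (F - s)) = 0) : v = s ∧ F = s := by
  have h1 := mul_nonneg (mul_pos hq hc).le (mul_real_sign_nonneg (v - s))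
  have h2 := mul_nonneg (mul_pos hq hq).le (sub_mul_sign_sub_sign_nonneg v F s)
  have h3 : q * c * ((v - s) * Real.sign (v - s)) = 0 := by linarith
  have hv : v = s := eq_of_sub_mul_sign_eq_zero
    ((mul_eq_zero.1 h3).resolve_left (mul_pos hq hc).ne')
  subst hv
  have h4 : q * q * ((F - v) * Real.sign (F - v)) = 0 := by
    simp only [sub_self, Real.sign_zero] at h
    linarith
  exact ⟨rfl, eq_of_sub_mul_sign_eq_zero ((mul_eq_zero.1 h4).resolve_left (mul_pos hq hq).ne')⟩

end SignPairing

section System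

/-- Truncating `u` at the level `log t` is the same as truncating `f(e^u)` at the level `f t`. -/
theorem sign_sub_log_eq {f : ℝ → ℝ} (hf : StrictMonoOn f (Ici 0)) {t : ℝ} (ht : 0 < t) (y : ℝ) :
    Real.sign (y - Real.log t) = Real.sign (f (Real.exp y) - f t) := by
  have hy : Real.exp y ∈ Ici (0 : ℝ) := (Real.exp_pos y).le
  have ht' : t ∈ Ici (0 : ℝ) := ht.le
  rcases lt_trichotomy y (Real.log t) with h | h | h
  · rw [Real.sign_of_neg (sub_neg.2 h),
      Real.sign_of_neg (sub_neg.2 (hf hy ht' ((Real.lt_log_iff_exp_lt ht).1 h)))]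
  · rw [h, Real.exp_log ht, sub_self, sub_self]
  · rw [Real.sign_of_pos (sub_pos.2 h),
      Real.sign_of_pos (sub_pos.2 (hf ht' hy ((Real.log_lt_iff_lt_exp ht).1 h)))]

variable {M : Type*} [TopologicalSpace M] [T2Space M] [CompactSpace M]
  [ChartedSpace Plane M] [IsManifold (𝓡 2) ∞ M]
  [RiemannianBundle (fun x : M => TangentSpace (𝓡 2) x)]
  [IsContMDiffRiemannianBundle (𝓡 2) ∞ Plane (fun x : M => TangentSpace (𝓡 2) x)]
  [MeasurableSpace M] [BorelSpace M]

/-- Both Kato inequalities hold, but the sum of their integrands is nonpositive, so it vanishes almost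
everywhere. -/
theorem IsVortexFreeSolution.ae_eq {f : ℝ → ℝ} {s q : ℝ} {u v : M → ℝ}
    (huv : IsVortexFreeSolution f s q u v) (hf_mono : StrictMonoOn f (Ici 0))
    (hf_deriv : ∀ t : ℝ, 0 < t → 0 < derivWithin f (Ici 0) t) (hq : 0 < q)
    {t : ℝ} (ht : 0 < t) (hts : f t = s) :
    ∀ᵐ x ∂(riemannianVolume M), Real.exp (u x) = t ∧ v x = s := by
  have hu := huv.eq_u.integral_mul_sign_nonneg (Real.log t)
  have hv := huv.eq_v.integral_mul_sign_nonneg s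
  have hu_int := (huv.eq_u.integrable_mul_sign (Real.log t)).const_mul q
  have hv_int := huv.eq_v.integrable_mul_sign s
  simp only [sign_sub_log_eq hf_mono ht, hts] at hu hu_int
  have hc : ∀ x, 0 < derivWithin f (Ici 0) (Real.exp (u x)) * Real.exp (u x) := fun x =>
    mul_pos (hf_deriv _ (Real.exp_pos _)) (Real.exp_pos _)
  have hsum := hv_int.add hu_int
  have hle : 0 ≤ᵐ[riemannianVolume M] fun x => -(_ : ℝ) :=
    ae_of_all _ fun x => neg_nonneg.2
      (sign_pairing_nonpos (v := v x) (F := f (Real.exp (u x))) (s := s) hq (hc x))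
  have hzero := (integral_eq_zero_iff_of_nonneg_ae hle hsum.neg).1 (le_antisymm (by
    rw [integral_neg, integral_add hv_int hu_int, integral_const_mul]
    have := mul_nonneg hq.le hu
    linarith) (integral_nonneg_of_ae hle))
  filter_upwards [hzero] with x hx
  obtain ⟨h1, h2⟩ := eq_of_sign_pairing_eq_zero hq (hc x) (neg_eq_zero.1 hx)
  exact ⟨hf_mono.injOn (mem_Ici.2 (Real.exp_pos _).le) (mem_Ici.2 ht.le) (h2.trans hts.symm), h1⟩

theorem isVortexFreeSolution_of_ae_eq {f : ℝ → ℝ} {s q : ℝ} {u v : M → ℝ} {t : ℝ}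
    (hts : f t = s) (huv : ∀ᵐ x ∂(riemannianVolume M), Real.exp (u x) = t ∧ v x = s) :
    IsVortexFreeSolution f s q u v where
  eq_u := by
    refine isWeakPoissonSolution_of_ae_const (r := Real.log t) ?_ ?_
    · filter_upwards [huv] with x hx
      rw [← hx.1, Real.log_exp]
    · filter_upwards [huv] with x hx
      simp [hx.1, hx.2, hts]
  eq_v := by
    refine isWeakPoissonSolution_of_ae_const (r := s) ?_ ?_
    · filter_upwards [huv] with x hx
      exact hx.2
    · filter_upwards [huv] with x hx
      simp [hx.1, hx.2, hts]

end System

theorem corollary1 {M : Type*} [TopologicalSpace M] [T2Space M] [CompactSpace M]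
    [ChartedSpace Plane M] [IsManifold (𝓡 2) ∞ M]
    [RiemannianBundle (fun x : M => TangentSpace (𝓡 2) x)]
    [IsContMDiffRiemannianBundle (𝓡 2) ∞ Plane (fun x : M => TangentSpace (𝓡 2) x)]
    [MeasurableSpace M] [BorelSpace M]
    (f : ℝ → ℝ) (hf_smooth : ContDiffOn ℝ ∞ f (Ici 0)) (hf_mono : StrictMonoOn f (Ici 0))
    (hf_deriv : ∀ t : ℝ, 0 < t → 0 < derivWithin f (Ici 0) t)
    (s : ℝ) (hs_lower : f 0 < s) (hs_upper : ∃ t : ℝ, 0 < t ∧ s < f t)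
    (q : ℝ) (hq : 0 < q) :
    ∃ t : ℝ, 0 < t ∧ (∀ τ : ℝ, 0 ≤ τ → (f τ = s ↔ τ = t)) ∧
      ∀ u v : M → ℝ, IsVortexFreeSolution f s q u v ↔
        ∀ᵐ x ∂(riemannianVolume M), Real.exp (u x) = t ∧ v x = s := by
  obtain ⟨T, hT, hsT⟩ := hs_upper
  obtain ⟨t, ht, hts⟩ := intermediate_value_Ioo hT.le
    (hf_smooth.continuousOn.mono Icc_subset_Ici_self) ⟨hs_lower, hsT⟩
  refine ⟨t, ht.1, fun τ hτ => ⟨fun h => ?_, fun h => h ▸ hts⟩,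
    fun u v => ⟨fun h => ?_, fun h => ?_⟩⟩
  · exact hf_mono.injOn (mem_Ici.2 hτ) (mem_Ici.2 ht.1.le) (h.trans hts.symm)
  · exact h.ae_eq hf_mono hf_deriv hq ht.1 hts
  · exact isVortexFreeSolution_of_ae_eq hts h
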